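/- **Theorem.** Consider $n$ bins, where bin $i$ has a positive integer weight $N_i$, and let $N=\sum_{i=1}^n N_i$. Let $\mathcal D$ be a probability distribution on the bins that is $(\alpha,\beta)$-biased, i.e. $$\frac{N_i}{\alpha N}\le \Pr_{i^*\sim\mathcal D}[i^*=i]\le \frac{\beta N_i}{N}\qquad\text{for every bin } i,$$ where $\alpha>1$ and $\beta>1$. All bins start empty. In each round two bins are sampled independently, with replacement, from $\mathcal D$, and a ball of unit weight is placed into the sampled bin whose value is smaller, where the value of bin $i$ is the number of balls in it divided by $N_i$; ties are broken by an arbitrary, possibly randomized rule that depends only on the round, the current loads and the two sampled bins. Let $v_i(t)$ be the value of bin $i$ after $t$ rounds and $\mathrm{Gap}(t)=\max_i v_i(t)-\min_j v_j(t)$. For every $\epsilon>0$ there are constants $a,c>0$ depending only on $\epsilon$ such that the following holds for all $n$, $(N_i)$, $\alpha$, $\beta$, $\mathcal D$ and tie-breaking rules as above. If $$\epsilon\le\frac{2\ln\left(\frac{\alpha\beta-1}{\alpha\beta-\beta}\right)}{\ln\left(\frac{\alpha\beta-1}{\alpha-1}\right)}-1,$$ then for every real $k>0$ and every integer $t\ge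 0$, $$\Pr\left[\mathrm{Gap}(t)\ge \frac{k}{a}\,\ln\left(\frac{c}{2a}\,N\right)\right]\le N^{-(k-1)}.$$ -/

import Mathlib

noncomputable section

namespace BallsBins

/-- The total weight of the bins, where bin `i` has the integer weight `N i`. -/
def totalWeight {n : ℕ} (N : Fin n → ℕ) : ℕ := ∑ i, N i

/-- A distribution `D` on the bins is `(α, β)`-biased with respect to the bin weights `N`: bin `i` is
sampled with probability between `N i / (α * N_total)` and `β * N i / N_total`. -/
def IsBiased {n : ℕ} (N : Fin n → ℕ) (α β : ℝ) (D : PMF (Fin n)) : Prop :=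
  ∀ i, (N i : ℝ) / (α * totalWeight N) ≤ (D i).toReal ∧
    (D i).toReal ≤ β * N i / totalWeight N

/-- The value of bin `i` when `w i` unit-weight balls have been put into it: `w i / N i`. -/
def value {n : ℕ} (N : Fin n → ℕ) (w : Fin n → ℕ) (i : Fin n) : ℝ := (w i : ℝ) / N i

/-- The difference between the largest and the smallest value of a bin. -/
def gap {n : ℕ} (N : Fin n → ℕ) (w : Fin n → ℕ) : ℝ :=
  (⨆ i, value N w i) - ⨅ i, value N w i

/-- The bin that receives the ball when bins `x` and `y` were sampled: the one of smaller value.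
If the values are equal, the bit `b` decides. -/
def chosenBin {n : ℕ} (N : Fin n → ℕ) (w : Fin n → ℕ) (x y : Fin n) (b : Bool) : Fin n :=
  if value N w x < value N w y then x
  else if value N w y < value N w x then y
  else if b then x else y

/-- A (possibly randomized) tie-breaking rule: the law of the deciding bit, given the number of
balls thrown so far, the current loads and the two sampled bins. -/
abbrev TieRule (n : ℕ) : Type := ℕ → (Fin n → ℕ) → Fin n → Fin n → PMF Bool

/-- The law of the load vector (number of unit-weight balls in each bin) after `t` rounds. The bins
start empty; in each round two bins are sampled independently, with replacement, from `D`, and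
one ball is added to the sampled bin of smaller value. -/
def loadLaw {n : ℕ} (N : Fin n → ℕ) (D : PMF (Fin n)) (τ : TieRule n) : ℕ → PMF (Fin n → ℕ)
  | 0 => PMF.pure 0
  | t + 1 =>
    (loadLaw N D τ t).bind fun w =>
      D.bind fun x =>
        D.bind fun y =>
          (τ t w x y).bind fun b =>
            PMF.pure (w + Pi.single (chosenBin N w x y b) 1)

end BallsBins

end

/-!
The proof follows the potential
`V(w) = ∑ i, N i * cosh (a * (value of bin i - average value))` with `a` a small multiple of `ε`, and
shows that its expectation never exceeds `2 * totalWeight N`. Markov's inequality then bounds the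
gap, because `exp (a * gap / 2) ≤ 2 * V`.

*Majorization.* Let `ν` be the distribution proportional to the weights. A set of bins with `ν`-mass
`s` has `D`-mass at most `min (β * s) (1 - (1 - s) / α)`. The hypothesis on `ε` says exactly that the
point where these two lines cross lies below the graph of the concave function `s ^ ((1 + ε) / 2)`;
hence the `D`-mass is at most this function everywhere (`mass_le_rpow`), and its square is at most
`(1 - ε) * s + ε * s ^ 2` (`mass_sq_le`). If `G i` is an increasing function of the value of bin `i`,
the bin that receives the ball has `G` equal to `min (G x) (G y)`, whatever the tie-breaking rule,
and a layer-cake decomposition of the minimum turns the bound on squares into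
`E[min (G x) (G y)] ≤ ∑ ν G - (ε / 2) * ∑∑ ν ν |G x - G y|` (`sum_sum_mul_min_le`).

*Drift.* To second order in `a`, the chosen bin enters the increment of the potential through
`a * sinh h + a ^ 2 * cosh h`, where `h` is its scaled deviation. This is increasing in `h`, so the
majorization applies to it with the error term included, and no bound on `β` is needed. The negative
term is a multiple of the mean absolute difference of `sinh h`. Since `h` has `ν`-mean zero, this
mean difference is at least half the mean of `|sinh h|` (`abs_sinh_le_two_mul_sum`), hence it
controls the potential up to a constant (`potential_le_sum_abs_sinh_sub`). The result is
`E[V'] ≤ (1 - ε ^ 2 / (512 * totalWeight N)) * V + ε ^ 2 / 256` (`sum_sum_mul_nextBound_le`), with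
fixed point `2 * totalWeight N`.
-/

namespace BallsBins

/-! ### Hyperbolic functions -/

theorem cosh_add_le (y : ℝ) {d : ℝ} (hd : |d| ≤ 1) :
    Real.cosh (y + d) ≤ Real.cosh y + d ^ 2 * Real.cosh y + d * Real.sinh y := by
  have h1 := (abs_le.1 (Real.abs_exp_sub_one_sub_id_le hd)).2
  have h2 := (abs_le.1 (Real.abs_exp_sub_one_sub_id_le (x := -d) (by rwa [abs_neg]))).2
  have h3 : Real.exp y * Real.exp d ≤ Real.exp y * (1 + d + d ^ 2) := by gcongr; linarith
  have h4 : Real.exp (-y) * Real.exp (-d) ≤ Real.exp (-y) * (1 - d + d ^ 2) := by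
    gcongr; nlinarith
  rw [Real.cosh_eq, Real.cosh_eq, Real.sinh_eq, neg_add, Real.exp_add, Real.exp_add]
  linarith

theorem abs_cosh_sub_cosh_le (u v : ℝ) :
    |Real.cosh u - Real.cosh v| ≤ |Real.sinh u - Real.sinh v| := by
  wlog h : v ≤ u generalizing u v
  · rw [abs_sub_comm, abs_sub_comm (Real.sinh u)]
    exact this v u (le_of_not_ge h)
  have h1 : Real.exp v ≤ Real.exp u := Real.exp_le_exp.2 h
  have h2 : Real.exp (-u) ≤ Real.exp (-v) := Real.exp_le_exp.2 (neg_le_neg h)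
  rw [abs_of_nonneg (sub_nonneg.2 (Real.sinh_le_sinh.2 h)), abs_le]
  simp only [Real.cosh_eq, Real.sinh_eq]
  constructor <;> linarith

theorem monotone_mul_sinh_add_sq_mul_cosh {a : ℝ} (ha : 0 ≤ a) (ha1 : a ≤ 1) :
    Monotone fun y => a * Real.sinh y + a ^ 2 * Real.cosh y := by
  intro u v h
  have h1 := abs_cosh_sub_cosh_le v u
  rw [abs_of_nonneg (sub_nonneg.2 (Real.sinh_le_sinh.2 h))] at h1
  have h2 := (abs_le.1 h1).1
  have h3 : 0 ≤ Real.sinh v - Real.sinh u := sub_nonneg.2 (Real.sinh_le_sinh.2 h)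
  have h4 : a ^ 2 * (Real.cosh u - Real.cosh v) ≤ a ^ 2 * (Real.sinh v - Real.sinh u) :=
    mul_le_mul_of_nonneg_left (by linarith) (sq_nonneg a)
  have h5 : a ^ 2 * (Real.sinh v - Real.sinh u) ≤ a * (Real.sinh v - Real.sinh u) :=
    mul_le_mul_of_nonneg_right (by nlinarith) h3
  simp only
  linarith

theorem cosh_le_abs_sinh_add_one (x : ℝ) : Real.cosh x ≤ |Real.sinh x| + 1 := by
  refine abs_le_of_sq_le_sq' ?_ (by positivity) |>.2
  rw [Real.cosh_sq, add_sq, sq_abs]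
  nlinarith [abs_nonneg (Real.sinh x)]

/-- The function `sinh x / x` is increasing on the positive half-line, with denominators cleared. -/
theorem mul_sinh_le_mul_sinh {x y : ℝ} (hx : 0 ≤ x) (hxy : x ≤ y) :
    y * Real.sinh x ≤ x * Real.sinh y := by
  have hconv : ConvexOn ℝ (Set.Ici 0) Real.sinh := by
    refine MonotoneOn.convexOn_of_deriv (convex_Ici 0) Real.continuous_sinh.continuousOn
      Real.differentiable_sinh.differentiableOn ?_
    rw [Real.deriv_sinh, interior_Ici]
    intro u hu v hv huv
    rw [Real.cosh_le_cosh, abs_of_pos hu, abs_of_pos hv]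
    exact huv
  rcases hx.eq_or_lt with rfl | hx0
  · simp
  have hy : 0 < y := hx0.trans_le hxy
  have h := hconv.2 (Set.mem_Ici.2 hy.le) (Set.mem_Ici.2 (le_refl (0 : ℝ)))
    (show 0 ≤ x / y by positivity) (sub_nonneg.2 ((div_le_one hy).2 hxy))
    (add_sub_cancel (x / y) 1)
  simp only [smul_eq_mul, mul_zero, add_zero, Real.sinh_zero, div_mul_cancel₀ x hy.ne'] at h
  calc y * Real.sinh x ≤ y * (x / y * Real.sinh y) := by gcongr
    _ = x * Real.sinh y := by field_simp

theorem sinh_mul_sub_le {H : ℝ} (hH : 0 ≤ H) (h : ℝ) :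
    Real.sinh H * (H - h) ≤ 2 * H * |Real.sinh h - Real.sinh H| := by
  have hs : 0 ≤ Real.sinh H := Real.sinh_nonneg_iff.2 hH
  have habs : Real.sinh H - Real.sinh h ≤ |Real.sinh h - Real.sinh H| := by
    rw [abs_sub_comm]; exact le_abs_self _
  have hmul := mul_le_mul_of_nonneg_left habs hH
  have hnn := mul_nonneg hH (abs_nonneg (Real.sinh h - Real.sinh H))
  rcases le_total H h with h1 | h1
  · nlinarith [mul_nonneg hs (sub_nonneg.2 h1)]
  rcases le_total 0 h with h2 | h2
  · have := mul_sinh_le_mul_sinh h2 h1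
    linarith
  have h3 : 0 ≤ Real.sinh (-h) := Real.sinh_nonneg_iff.2 (by linarith)
  have h4 := Real.sinh_neg h
  rcases le_total (-h) H with h5 | h5
  · nlinarith [mul_nonneg hH h3, mul_nonneg hs (show 0 ≤ H + h by linarith)]
  · have := mul_sinh_le_mul_sinh hH h5
    nlinarith

/-- If `h` has mean zero, then the mean distance of `sinh h` to any level `sinh H` controls that
level: the mass of `h` has to balance around zero, and `sinh` has slope at least `sinh H / (2 * H)`
as seen from `H`. -/
theorem abs_sinh_le_two_mul_sum {ι : Type*} [Fintype ι] {ν h : ι → ℝ} (hν : ∀ i, 0 ≤ ν i)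
    (hν1 : ∑ i, ν i = 1) (hmean : ∑ i, ν i * h i = 0) (H : ℝ) :
    |Real.sinh H| ≤ 2 * ∑ i, ν i * |Real.sinh (h i) - Real.sinh H| := by
  wlog hH : 0 ≤ H generalizing h H
  · have := this (h := fun i => -h i) (by simp [hmean]) (-H) (by linarith)
    refine (by simpa using this : _ ≤ _).trans_eq ?_
    congr 1
    refine Finset.sum_congr rfl fun i _ => ?_
    rw [← abs_neg]
    congr 2
    ring
  rcases hH.eq_or_lt with rfl | hpos
  · simpa using Finset.sum_nonneg fun i _ => mul_nonneg (hν i) (abs_nonneg (Real.sinh (h i)))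
  rw [abs_of_nonneg (Real.sinh_nonneg_iff.2 hH)]
  have key : ∑ i, ν i * (Real.sinh H * (H - h i)) ≤
      ∑ i, ν i * (2 * H * |Real.sinh (h i) - Real.sinh H|) :=
    Finset.sum_le_sum fun i _ => mul_le_mul_of_nonneg_left (sinh_mul_sub_le hH _) (hν i)
  have e1 : ∑ i, ν i * (Real.sinh H * (H - h i)) = H * Real.sinh H := by
    calc _ = Real.sinh H * H * ∑ i, ν i - Real.sinh H * ∑ i, ν i * h i := by
          rw [Finset.mul_sum, Finset.mul_sum, ← Finset.sum_sub_distrib]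
          exact Finset.sum_congr rfl fun i _ => by ring
      _ = _ := by rw [hν1, hmean]; ring
  have e2 : ∑ i, ν i * (2 * H * |Real.sinh (h i) - Real.sinh H|) =
      H * (2 * ∑ i, ν i * |Real.sinh (h i) - Real.sinh H|) := by
    rw [Finset.mul_sum, Finset.mul_sum]
    exact Finset.sum_congr rfl fun i _ => by ring
  rw [e1, e2] at key
  exact le_of_mul_le_mul_left key hpos

/-! ### Majorization of the two-choice law -/

theorem epsilon_lt_one {ε α β : ℝ} (hα : 1 < α) (hβ : 1 < β)
    (h : ε ≤ 2 * Real.log ((α * β - 1) / (α * β - β)) /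
          Real.log ((α * β - 1) / (α - 1)) - 1) : ε < 1 := by
  have h1 : 0 < α - 1 := by linarith
  have h2 : α - 1 < α * β - β := by nlinarith
  have h3 : α * β - β < α * β - 1 := by linarith
  have hlog : Real.log ((α * β - 1) / (α * β - β)) < Real.log ((α * β - 1) / (α - 1)) :=
    Real.log_lt_log (div_pos (by linarith) (by linarith))
      (div_lt_div_of_pos_left (by linarith) h1 h2)
  have hpos : 0 < Real.log ((α * β - 1) / (α - 1)) :=
    Real.log_pos ((one_lt_div h1).2 (by linarith))
  have := (div_lt_iff₀ hpos).2
    (show 2 * Real.log ((α * β - 1) / (α * β - β)) < 2 * Real.log ((α * β - 1) / (α - 1)) by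
      linarith)
  linarith

/-- The two linear bounds on the mass of a set of relative weight `s` cross at
`s₀ = (α - 1) / (α * β - 1)`; the hypothesis on `ε` says that the crossing point lies below the
graph of `s ^ ((1 + ε) / 2)`. -/
theorem crossing_le_rpow {ε α β : ℝ} (hα : 1 < α) (hβ : 1 < β)
    (h : ε ≤ 2 * Real.log ((α * β - 1) / (α * β - β)) /
          Real.log ((α * β - 1) / (α - 1)) - 1) :
    β * ((α - 1) / (α * β - 1)) ≤ ((α - 1) / (α * β - 1)) ^ ((1 + ε) / 2) := by
  have h1 : 0 < α - 1 := by linarith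
  have h2 : 0 < α * β - β := by nlinarith
  have h3 : 0 < α * β - 1 := by linarith
  have hpos : 0 < Real.log ((α * β - 1) / (α - 1)) :=
    Real.log_pos ((one_lt_div h1).2 (by nlinarith))
  have h4 : (1 + ε) * Real.log ((α * β - 1) / (α - 1)) ≤
      2 * Real.log ((α * β - 1) / (α * β - β)) := (le_div_iff₀ hpos).1 (by linarith)
  have h5 : 0 < (α - 1) / (α * β - 1) := div_pos h1 h3
  rw [← Real.log_le_log_iff (by positivity) (by positivity), Real.log_rpow h5]
  have e1 : β * ((α - 1) / (α * β - 1)) = ((α * β - 1) / (α * β - β))⁻¹ := by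
    rw [inv_div]; ring
  rw [e1, ← inv_div (α * β - 1) (α - 1), Real.log_inv, Real.log_inv]
  linarith

/-- A set of bins of relative weight `s` and mass `d` under a biased distribution has
`d ≤ s ^ ((1 + ε) / 2)`: both linear bounds on `d` lie below this concave function on their side of
the crossing point. -/
theorem mass_le_rpow {ε α β s d : ℝ} (hε : 0 < ε) (hα : 1 < α) (hβ : 1 < β)
    (h : ε ≤ 2 * Real.log ((α * β - 1) / (α * β - β)) /
          Real.log ((α * β - 1) / (α - 1)) - 1)
    (hs0 : 0 < s) (hs1 : s ≤ 1) (hd1 : d ≤ β * s) (hd2 : d ≤ 1 - (1 - s) / α) :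
    d ≤ s ^ ((1 + ε) / 2) := by
  have hε1 := epsilon_lt_one hα hβ h
  have hc := crossing_le_rpow hα hβ h
  have h1 : 0 < α - 1 := by linarith
  have h3 : 0 < α * β - 1 := by nlinarith
  set s₀ := (α - 1) / (α * β - 1) with hs₀
  set p := (1 + ε) / 2 with hp
  have hpos : 0 < s₀ := div_pos h1 h3
  have hlt : s₀ < 1 := (div_lt_one h3).2 (by nlinarith)
  have split : ∀ x : ℝ, 0 < x → x = x ^ p * x ^ (1 - p) := fun x hx => by
    rw [← Real.rpow_add hx]; simp
  rcases le_total s s₀ with hle | hle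
  · refine hd1.trans ?_
    have h4 : β * s₀ ^ (1 - p) ≤ 1 := by
      have h5 : s₀ ^ p * (β * s₀ ^ (1 - p)) ≤ s₀ ^ p * 1 := by
        calc _ = β * (s₀ ^ p * s₀ ^ (1 - p)) := by ring
          _ = β * s₀ := by rw [← split s₀ hpos]
          _ ≤ _ := by rw [mul_one]; exact hc
      exact le_of_mul_le_mul_left h5 (by positivity)
    calc β * s = s ^ p * (β * s ^ (1 - p)) := by
          conv_lhs => rw [split s hs0]
          ring
      _ ≤ s ^ p * (β * s₀ ^ (1 - p)) := by
          have : s ^ (1 - p) ≤ s₀ ^ (1 - p) := Real.rpow_le_rpow hs0.le hle (by linarith)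
          gcongr
      _ ≤ s ^ p * 1 := by gcongr
      _ = s ^ p := mul_one _
  · refine hd2.trans ?_
    have hne : (0 : ℝ) < 1 - s₀ := by linarith
    have hcc := (Real.concaveOn_rpow (p := p) (by linarith) (by linarith)).2
      (Set.mem_Ici.2 hpos.le) (Set.mem_Ici.2 zero_le_one)
      (show 0 ≤ (1 - s) / (1 - s₀) from div_nonneg (by linarith) hne.le)
      (sub_nonneg.2 ((div_le_one hne).2 (by linarith))) (add_sub_cancel _ _)
    have e : (1 - s) / (1 - s₀) * s₀ + (1 - (1 - s) / (1 - s₀)) * 1 = s := by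
      field_simp; ring
    simp only [smul_eq_mul] at hcc
    rw [e, Real.one_rpow] at hcc
    have h6 : (1 - s) / (1 - s₀) * (β * s₀) ≤ (1 - s) / (1 - s₀) * s₀ ^ p :=
      mul_le_mul_of_nonneg_left hc (div_nonneg (by linarith) hne.le)
    have e2 : (1 - s) / (1 - s₀) * (1 - β * s₀) = (1 - s) / α := by
      have hb : 0 < β - 1 := by linarith
      have f0 : s₀ * (α * β - 1) = α - 1 := div_mul_cancel₀ _ h3.ne'
      have f1 : 1 - s₀ = α * (β - 1) / (α * β - 1) := by
        rw [eq_div_iff h3.ne']; linear_combination -f0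
      have f2 : 1 - β * s₀ = (β - 1) / (α * β - 1) := by
        rw [eq_div_iff h3.ne']; linear_combination -β * f0
      rw [f1, f2]
      field_simp
    linarith

theorem mass_sq_le {ε α β s d : ℝ} (hε : 0 < ε) (hα : 1 < α) (hβ : 1 < β)
    (h : ε ≤ 2 * Real.log ((α * β - 1) / (α * β - β)) /
          Real.log ((α * β - 1) / (α - 1)) - 1)
    (hs0 : 0 ≤ s) (hs1 : s ≤ 1) (hd0 : 0 ≤ d) (hd1 : d ≤ β * s) (hd2 : d ≤ 1 - (1 - s) / α) :
    d ^ 2 ≤ (1 - ε) * s + ε * s ^ 2 := by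
  rcases hs0.eq_or_lt with rfl | hs
  · have : d = 0 := by linarith
    simp [this]
  have hb := rpow_one_add_le_one_add_mul_self (s := s - 1) (by linarith) hε.le
    (epsilon_lt_one hα hβ h).le
  rw [add_sub_cancel] at hb
  calc d ^ 2 ≤ (s ^ ((1 + ε) / 2)) ^ 2 :=
        pow_le_pow_left₀ hd0 (mass_le_rpow hε hα hβ h hs hs1 hd1 hd2) 2
    _ = s * s ^ ε := by
        rw [← Real.rpow_natCast, ← Real.rpow_mul hs.le]
        conv_rhs => rw [← Real.rpow_one_add' hs.le (by linarith)]
        congr 1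
        push_cast
        ring
    _ ≤ s * (1 + ε * (s - 1)) := by gcongr
    _ = _ := by ring

/-- A discrete layer-cake argument: if every square block `S × S` of the matrix `c` has nonpositive
sum, then so has `c` weighted by `min (G x) (G y)`, which is a positive combination of indicators
of the blocks `{G > r} × {G > r}`. -/
theorem sum_mul_min_nonpos {ι : Type*} [DecidableEq ι] (c : ι → ι → ℝ) (T : Finset ι)
    (hc : ∀ S ⊆ T, ∑ x ∈ S, ∑ y ∈ S, c x y ≤ 0) (G : ι → ℝ) (hG : ∀ x ∈ T, 0 ≤ G x) :
    ∑ x ∈ T, ∑ y ∈ T, c x y * min (G x) (G y) ≤ 0 := by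
  induction T using Finset.strongInduction generalizing G with
  | H T ih =>
    rcases T.eq_empty_or_nonempty with rfl | hT
    · simp
    obtain ⟨z, hz, hmin⟩ := T.exists_min_image G hT
    have hrest : ∑ x ∈ T.erase z, ∑ y ∈ T.erase z, c x y * min (G x - G z) (G y - G z) ≤ 0 :=
      ih _ (Finset.erase_ssubset hz) (fun S hS => hc S (hS.trans (Finset.erase_subset _ _)))
        (fun x => G x - G z) fun x hx => sub_nonneg.2 (hmin x (Finset.mem_of_mem_erase hx))
    have e1 : ∑ x ∈ T.erase z, ∑ y ∈ T.erase z, c x y * min (G x - G z) (G y - G z) =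
        ∑ x ∈ T, ∑ y ∈ T, c x y * min (G x - G z) (G y - G z) := by
      rw [Finset.sum_erase]
      · refine Finset.sum_congr rfl fun x hx => Finset.sum_erase _ ?_
        rw [sub_self, min_eq_right (sub_nonneg.2 (hmin x hx)), mul_zero]
      · refine Finset.sum_eq_zero fun y hy => ?_
        rw [sub_self, min_eq_left (sub_nonneg.2 (hmin y (Finset.mem_of_mem_erase hy))), mul_zero]
    have e2 : ∑ x ∈ T, ∑ y ∈ T, c x y * min (G x) (G y) =
        G z * ∑ x ∈ T, ∑ y ∈ T, c x y +
          ∑ x ∈ T, ∑ y ∈ T, c x y * min (G x - G z) (G y - G z) := by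
      rw [Finset.mul_sum, ← Finset.sum_add_distrib]
      refine Finset.sum_congr rfl fun x _ => ?_
      rw [Finset.mul_sum, ← Finset.sum_add_distrib]
      refine Finset.sum_congr rfl fun y _ => ?_
      rw [min_sub_sub_right]
      ring
    rw [e2, ← e1]
    nlinarith [mul_nonneg (hG z hz) (neg_nonneg.2 (hc T subset_rfl))]

theorem sum_sum_mul_min_le {ι : Type*} [Fintype ι] {ε : ℝ} {D ν : ι → ℝ} (hD : ∑ i, D i = 1)
    (hν : ∑ i, ν i = 1)
    (hmass : ∀ S : Finset ι, (∑ i ∈ S, D i) ^ 2 ≤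
      (1 - ε) * ∑ i ∈ S, ν i + ε * (∑ i ∈ S, ν i) ^ 2) (G : ι → ℝ) :
    ∑ x, ∑ y, D x * D y * min (G x) (G y) ≤
      ∑ x, ν x * G x - ε / 2 * ∑ x, ∑ y, ν x * ν y * |G x - G y| := by
  classical
  set c : ι → ι → ℝ := fun x y =>
    D x * D y - ((1 - ε) * (if x = y then ν x else 0) + ε * (ν x * ν y)) with hc
  have hblock : ∀ S : Finset ι, ∑ x ∈ S, ∑ y ∈ S, c x y =
      (∑ i ∈ S, D i) ^ 2 - ((1 - ε) * ∑ i ∈ S, ν i + ε * (∑ i ∈ S, ν i) ^ 2) := by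
    intro S
    simp only [hc, Finset.sum_sub_distrib, Finset.sum_add_distrib, ← Finset.mul_sum, sq,
      Finset.sum_mul_sum]
    congr 3
    exact Finset.sum_congr rfl fun x hx => by simp [hx]
  set m : ℝ := -∑ i, |G i| with hm
  have hmG : ∀ x, 0 ≤ G x - m := fun x => by
    have h1 := Finset.single_le_sum (fun i _ => abs_nonneg (G i)) (Finset.mem_univ x)
    have h2 := neg_abs_le (G x)
    linarith
  have key := sum_mul_min_nonpos c Finset.univ
    (fun S _ => by rw [hblock]; linarith [hmass S]) (fun x => G x - m) fun x _ => hmG x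
  have e1 : ∑ x, ∑ y, c x y * min (G x - m) (G y - m) = ∑ x, ∑ y, c x y * min (G x) (G y) := by
    have : ∑ x, ∑ y, c x y * min (G x - m) (G y - m) =
        ∑ x, ∑ y, c x y * min (G x) (G y) - m * ∑ x, ∑ y, c x y := by
      simp only [min_sub_sub_right, mul_sub, Finset.sum_sub_distrib, Finset.mul_sum]
      congr 1
      exact Finset.sum_congr rfl fun x _ => Finset.sum_congr rfl fun y _ => mul_comm _ _
    rw [this, hblock, hD, hν]
    ring
  have e2 : ∑ x, ∑ y, c x y * min (G x) (G y) =
      ∑ x, ∑ y, D x * D y * min (G x) (G y) -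
        ((1 - ε) * ∑ x, ν x * G x + ε * ∑ x, ∑ y, ν x * ν y * min (G x) (G y)) := by
    have : ∀ x, ν x * G x = ∑ y, (if x = y then ν x else 0) * min (G x) (G y) := fun x => by
      simp
    simp_rw [this, Finset.mul_sum, ← Finset.sum_add_distrib, ← Finset.sum_sub_distrib]
    exact Finset.sum_congr rfl fun x _ => Finset.sum_congr rfl fun y _ => by
      simp only [hc]; ring
  have e3 : ∑ x, ∑ y, ν x * ν y * min (G x) (G y) =
      ∑ x, ν x * G x - 1 / 2 * ∑ x, ∑ y, ν x * ν y * |G x - G y| := by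
    have f1 : ∑ x, ∑ y, ν x * ν y * G x = ∑ x, ν x * G x := by
      refine Finset.sum_congr rfl fun x _ => ?_
      calc _ = ν x * G x * ∑ y, ν y := by
            rw [Finset.mul_sum]; exact Finset.sum_congr rfl fun y _ => by ring
        _ = _ := by rw [hν, mul_one]
    have f2 : ∑ x, ∑ y, ν x * ν y * G y = ∑ x, ν x * G x := by
      rw [Finset.sum_comm, ← f1]
      exact Finset.sum_congr rfl fun x _ => Finset.sum_congr rfl fun y _ => by ring
    have f3 : ∑ x, ∑ y, ν x * ν y * min (G x) (G y) =
        1 / 2 * (∑ x, ∑ y, ν x * ν y * G x + ∑ x, ∑ y, ν x * ν y * G y -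
          ∑ x, ∑ y, ν x * ν y * |G x - G y|) := by
      simp_rw [← Finset.sum_add_distrib, ← Finset.sum_sub_distrib, Finset.mul_sum]
      refine Finset.sum_congr rfl fun x _ => Finset.sum_congr rfl fun y _ => ?_
      rcases le_total (G x) (G y) with hxy | hxy
      · rw [min_eq_left hxy, abs_of_nonpos (sub_nonpos.2 hxy)]; ring
      · rw [min_eq_right hxy, abs_of_nonneg (sub_nonneg.2 hxy)]; ring
    rw [f3, f1, f2]
    ring
  rw [e1, e2, e3] at key
  linarith

/-! ### The potential and its drift -/

/-- The deviation of the value of bin `i` from the weighted average value of all bins, scaled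
by `a`. The average is the total number of balls divided by the total weight. -/
noncomputable def deviation {n : ℕ} (N : Fin n → ℕ) (a : ℝ) (w : Fin n → ℕ) (i : Fin n) : ℝ :=
  a * (value N w i - (∑ j, (w j : ℝ)) / totalWeight N)

/-- The potential of a load vector: the weighted sum of the hyperbolic cosines of the scaled
deviations from the average value. -/
noncomputable def potential {n : ℕ} (N : Fin n → ℕ) (a : ℝ) (w : Fin n → ℕ) : ℝ :=
  ∑ i, (N i : ℝ) * Real.cosh (deviation N a w i)

variable {n : ℕ} {N : Fin n → ℕ}

theorem cast_totalWeight (N : Fin n → ℕ) : (totalWeight N : ℝ) = ∑ i, (N i : ℝ) := by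
  simp [totalWeight]

theorem le_totalWeight (N : Fin n → ℕ) (i : Fin n) : N i ≤ totalWeight N :=
  Finset.single_le_sum (f := N) (fun _ _ => Nat.zero_le _) (Finset.mem_univ i)

theorem sum_mul_deviation (hN : ∀ i, 0 < N i) (hW : 0 < totalWeight N) (a : ℝ) (w : Fin n → ℕ) :
    ∑ i, (N i : ℝ) * deviation N a w i = 0 := by
  have hW' : (totalWeight N : ℝ) ≠ 0 := by exact_mod_cast hW.ne'
  have h1 : ∀ i, (N i : ℝ) * deviation N a w i =
      a * w i - a * ((∑ j, (w j : ℝ)) / totalWeight N) * N i := fun i => by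
    have : (N i : ℝ) ≠ 0 := by exact_mod_cast (hN i).ne'
    rw [deviation, value]
    field_simp
  simp_rw [h1, Finset.sum_sub_distrib, ← Finset.mul_sum, ← cast_totalWeight]
  field_simp
  ring

theorem deviation_add_single (N : Fin n → ℕ) (a : ℝ) (w : Fin n → ℕ) (i j : Fin n) :
    deviation N a (w + Pi.single i 1) j =
      deviation N a w j + a * ((if j = i then 1 / (N i : ℝ) else 0) - 1 / totalWeight N) := by
  have h1 : ∑ k, (((w + Pi.single i 1 : Fin n → ℕ) k : ℕ) : ℝ) = ∑ k, (w k : ℝ) + 1 := by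
    simp [Finset.sum_add_distrib, Pi.single_apply]
  have h2 : value N (w + Pi.single i 1) j = value N w j + if j = i then 1 / (N i : ℝ) else 0 := by
    by_cases h : j = i
    · subst h; simp [value, add_div]
    · simp [value, h]
  rw [deviation, deviation, h1, h2]
  ring

/-- Second-order expansion of the potential when a ball is put into bin `i`. -/
theorem potential_add_single_le (hN : ∀ i, 0 < N i) {a : ℝ} (ha : 0 ≤ a) (ha1 : a ≤ 1)
    (w : Fin n → ℕ) (i : Fin n) :
    potential N a (w + Pi.single i 1) ≤
      potential N a w + a ^ 2 * potential N a w / totalWeight N -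
        a / totalWeight N * ∑ j, (N j : ℝ) * Real.sinh (deviation N a w j) +
        (a * Real.sinh (deviation N a w i) + a ^ 2 * Real.cosh (deviation N a w i)) := by
  set W : ℝ := (totalWeight N : ℝ) with hW
  set h := deviation N a w with hh
  have hNi : ∀ j, (1 : ℝ) ≤ N j := fun j => by exact_mod_cast hN j
  have hWj : ∀ j, (N j : ℝ) ≤ W := fun j => Nat.cast_le.2 (le_totalWeight N j)
  have hW1 : 1 ≤ W := (hNi i).trans (hWj i)
  have hW0 : 0 < W := by linarith
  have hterm : ∀ j, (N j : ℝ) * Real.cosh (deviation N a (w + Pi.single i 1) j) ≤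
      N j * Real.cosh (h j) + a ^ 2 / W * (N j * Real.cosh (h j)) -
        a / W * (N j * Real.sinh (h j)) +
        if j = i then a * Real.sinh (h j) + a ^ 2 * Real.cosh (h j) else 0 := by
    intro j
    have hc := Real.cosh_pos (h j)
    have hNj := hNi j
    have hN0 : (0 : ℝ) < N j := by linarith
    have hq0 : 0 ≤ 1 / W := by positivity
    have hq1 : 1 / W ≤ 1 := (div_le_one hW0).2 hW1
    have hqq : (1 / W) ^ 2 ≤ 1 / W := by nlinarith
    rw [deviation_add_single, ← hW, ← hh]
    by_cases hji : j = i
    · subst hji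
      rw [if_pos rfl, if_pos rfl]
      have hp0 : 0 ≤ 1 / (N j : ℝ) := by positivity
      have hp1 : 1 / (N j : ℝ) ≤ 1 := (div_le_one hN0).2 hNj
      have hNp : (N j : ℝ) * (1 / N j) = 1 := by field_simp
      set p := 1 / (N j : ℝ)
      have hd : |a * (p - 1 / W)| ≤ 1 := by
        rw [abs_mul, abs_of_nonneg ha]
        exact mul_le_one₀ ha1 (abs_nonneg _) (abs_le.2 ⟨by linarith, by linarith⟩)
      have hsq : (N j : ℝ) * (p - 1 / W) ^ 2 ≤ N j * (1 / W) + 1 := by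
        have : (N j : ℝ) * (p - 1 / W) ^ 2 =
            N j * p * p - 2 * (N j * p) * (1 / W) + N j * (1 / W) ^ 2 := by ring
        rw [this, hNp]
        nlinarith
      have h1 := mul_le_mul_of_nonneg_left (cosh_add_le (h j) hd) hN0.le
      have h2 := mul_le_mul_of_nonneg_left hsq (mul_nonneg (sq_nonneg a) hc.le)
      have e1 : (N j : ℝ) * (a * (p - 1 / W) * Real.sinh (h j)) =
          a * (N j * p) * Real.sinh (h j) - a * (1 / W) * (N j * Real.sinh (h j)) := by ring
      rw [hNp] at e1
      have e2 : a / W = a * (1 / W) := by ring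
      have e3 : a ^ 2 / W = a ^ 2 * (1 / W) := by ring
      rw [e2, e3]
      linarith
    · rw [if_neg hji, if_neg hji]
      have hd : |a * (0 - 1 / W)| ≤ 1 := by
        rw [abs_mul, abs_of_nonneg ha]
        exact mul_le_one₀ ha1 (abs_nonneg _) (abs_le.2 ⟨by linarith, by linarith⟩)
      have h1 := mul_le_mul_of_nonneg_left (cosh_add_le (h j) hd) hN0.le
      have h2 := mul_le_mul_of_nonneg_left hqq
        (mul_nonneg (mul_nonneg hN0.le (sq_nonneg a)) hc.le)
      have e2 : a / W = a * (1 / W) := by ring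
      have e3 : a ^ 2 / W = a ^ 2 * (1 / W) := by ring
      rw [e2, e3]
      linarith
  calc potential N a (w + Pi.single i 1) ≤ _ := Finset.sum_le_sum fun j _ => hterm j
    _ = _ := by
      simp only [Finset.sum_add_distrib, Finset.sum_sub_distrib, ← Finset.mul_sum,
        Finset.sum_ite_eq', Finset.mem_univ, if_true]
      rw [← show potential N a w = ∑ j, (N j : ℝ) * Real.cosh (h j) from rfl]
      ring

theorem value_chosenBin_le (N w : Fin n → ℕ) (x y : Fin n) (b : Bool) :
    value N w (chosenBin N w x y b) ≤ min (value N w x) (value N w y) := by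
  unfold chosenBin
  split_ifs with h1 h2 h3
  · exact le_min le_rfl h1.le
  · exact le_min h2.le le_rfl
  · exact le_min le_rfl (not_lt.1 h2)
  · exact le_min (not_lt.1 h1) le_rfl

/-- The increment of the potential caused by the chosen bin, as a function of that bin, up to terms
that do not depend on the bin. It is an increasing function of the value of the bin. -/
noncomputable def increment (N : Fin n → ℕ) (a : ℝ) (w : Fin n → ℕ) (i : Fin n) : ℝ :=
  a * Real.sinh (deviation N a w i) + a ^ 2 * Real.cosh (deviation N a w i)

theorem increment_chosenBin_le (N : Fin n → ℕ) {a : ℝ} (ha : 0 ≤ a) (ha1 : a ≤ 1)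
    (w : Fin n → ℕ) (x y : Fin n) (b : Bool) :
    increment N a w (chosenBin N w x y b) ≤ min (increment N a w x) (increment N a w y) := by
  have hmono : ∀ i j, value N w i ≤ value N w j → increment N a w i ≤ increment N a w j :=
    fun i j hij => monotone_mul_sinh_add_sq_mul_cosh ha ha1
      (mul_le_mul_of_nonneg_left (sub_le_sub_right hij _) ha)
  have := le_min_iff.1 (value_chosenBin_le N w x y b)
  exact le_min (hmono _ _ this.1) (hmono _ _ this.2)

theorem mul_abs_sinh_sub_le_abs_increment_sub (N : Fin n → ℕ) {a : ℝ} (ha : 0 ≤ a)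
    (ha1 : a ≤ 1 / 2) (w : Fin n → ℕ) (x y : Fin n) :
    a / 2 * |Real.sinh (deviation N a w x) - Real.sinh (deviation N a w y)| ≤
      |increment N a w x - increment N a w y| := by
  set u := deviation N a w x with hu
  set v := deviation N a w y with hv
  have h1 := abs_cosh_sub_cosh_le u v
  have e : increment N a w x - increment N a w y =
      a * (Real.sinh u - Real.sinh v) - -(a ^ 2 * (Real.cosh u - Real.cosh v)) := by
    rw [increment, increment, ← hu, ← hv]; ring
  have h2 := abs_sub_abs_le_abs_sub (a * (Real.sinh u - Real.sinh v))
    (-(a ^ 2 * (Real.cosh u - Real.cosh v)))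
  rw [abs_neg, abs_mul, abs_mul, abs_of_nonneg ha, abs_of_nonneg (sq_nonneg a)] at h2
  rw [e]
  refine le_trans ?_ h2
  have h3 := mul_le_mul_of_nonneg_left h1 (sq_nonneg a)
  have h4 : a ^ 2 * |Real.sinh u - Real.sinh v| ≤ a / 2 * |Real.sinh u - Real.sinh v| :=
    mul_le_mul_of_nonneg_right (by nlinarith) (abs_nonneg _)
  linarith

/-- A bound on the potential after the next round, if bins `x` and `y` are sampled. -/
noncomputable def nextBound (N : Fin n → ℕ) (a : ℝ) (w : Fin n → ℕ) (x y : Fin n) : ℝ :=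
  potential N a w + a ^ 2 * potential N a w / totalWeight N -
    a / totalWeight N * ∑ j, (N j : ℝ) * Real.sinh (deviation N a w j) +
    min (increment N a w x) (increment N a w y)

theorem potential_add_chosenBin_le (hN : ∀ i, 0 < N i) {a : ℝ} (ha : 0 ≤ a) (ha1 : a ≤ 1)
    (w : Fin n → ℕ) (x y : Fin n) (b : Bool) :
    potential N a (w + Pi.single (chosenBin N w x y b) 1) ≤ nextBound N a w x y :=
  (potential_add_single_le hN ha ha1 w _).trans
    (add_le_add_right (increment_chosenBin_le N ha ha1 w x y b) _)

theorem potential_nonneg (N : Fin n → ℕ) (a : ℝ) (w : Fin n → ℕ) : 0 ≤ potential N a w :=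
  Finset.sum_nonneg fun _ _ => mul_nonneg (Nat.cast_nonneg _) (Real.cosh_pos _).le

/-- The mean absolute difference of `sinh` of the deviations controls the potential, because the
deviations have weighted mean zero. -/
theorem potential_le_sum_abs_sinh_sub (hN : ∀ i, 0 < N i) (hW : 0 < totalWeight N) (a : ℝ)
    (w : Fin n → ℕ) :
    potential N a w / totalWeight N - 1 ≤
      2 * ∑ x, ∑ y, (N x / totalWeight N : ℝ) * (N y / totalWeight N : ℝ) *
        |Real.sinh (deviation N a w x) - Real.sinh (deviation N a w y)| := by
  have hW' : (0 : ℝ) < totalWeight N := by exact_mod_cast hW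
  set h := deviation N a w with hh
  set ν : Fin n → ℝ := fun i => N i / totalWeight N with hν
  have hν0 : ∀ i, 0 ≤ ν i := fun i => by positivity
  have hν1 : ∑ i, ν i = 1 := by
    rw [hν, ← Finset.sum_div, ← cast_totalWeight, div_self hW'.ne']
  have hmean : ∑ i, ν i * h i = 0 := by
    have : ∀ i, ν i * h i = N i * h i / totalWeight N := fun i => by simp only [hν]; ring
    simp_rw [this, ← Finset.sum_div]
    rw [hh, sum_mul_deviation hN hW, zero_div]
  have e1 : potential N a w / totalWeight N = ∑ i, ν i * Real.cosh (h i) := by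
    rw [potential, Finset.sum_div]
    exact Finset.sum_congr rfl fun i _ => by simp only [hν]; ring
  have h1 : ∑ i, ν i * Real.cosh (h i) ≤ ∑ i, ν i * (2 * ∑ j, ν j *
      |Real.sinh (h i) - Real.sinh (h j)| + 1) := by
    refine Finset.sum_le_sum fun i _ => mul_le_mul_of_nonneg_left ?_ (hν0 i)
    refine (cosh_le_abs_sinh_add_one _).trans (add_le_add_left ?_ 1)
    simpa only [abs_sub_comm] using abs_sinh_le_two_mul_sum hν0 hν1 hmean (h i)
  have e2 : ∑ i, ν i * (2 * ∑ j, ν j * |Real.sinh (h i) - Real.sinh (h j)| + 1) =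
      2 * ∑ x, ∑ y, ν x * ν y * |Real.sinh (h x) - Real.sinh (h y)| + 1 := by
    simp_rw [mul_add, Finset.sum_add_distrib, mul_one]
    rw [hν1, Finset.mul_sum]
    congr 1
    refine Finset.sum_congr rfl fun i _ => ?_
    simp_rw [Finset.mul_sum]
    exact Finset.sum_congr rfl fun j _ => by ring
  rw [e1]
  linarith

/-- The mass that a biased distribution gives to a set of bins, squared, is below the mass that
a mixture of one and two weighted-uniform choices gives to it. -/
theorem IsBiased.sum_sq_le {ε α β : ℝ} (hε : 0 < ε) (hα : 1 < α) (hβ : 1 < β)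
    (h : ε ≤ 2 * Real.log ((α * β - 1) / (α * β - β)) /
          Real.log ((α * β - 1) / (α - 1)) - 1)
    (hW : 0 < totalWeight N) {D : PMF (Fin n)} (hD : IsBiased N α β D)
    (hD1 : ∑ i, (D i).toReal = 1) (S : Finset (Fin n)) :
    (∑ i ∈ S, (D i).toReal) ^ 2 ≤ (1 - ε) * ∑ i ∈ S, (N i / totalWeight N : ℝ) +
      ε * (∑ i ∈ S, (N i / totalWeight N : ℝ)) ^ 2 := by
  have hW' : (0 : ℝ) < totalWeight N := by exact_mod_cast hW
  have hν1 : ∑ i, (N i / totalWeight N : ℝ) = 1 := by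
    rw [← Finset.sum_div, ← cast_totalWeight, div_self hW'.ne']
  have hsplit := Finset.sum_add_sum_compl S fun i => (N i / totalWeight N : ℝ)
  have hsplitD := Finset.sum_add_sum_compl S fun i => (D i).toReal
  have hc : 0 ≤ ∑ i ∈ Sᶜ, (N i / totalWeight N : ℝ) :=
    Finset.sum_nonneg fun i _ => by positivity
  refine mass_sq_le hε hα hβ h (Finset.sum_nonneg fun i _ => by positivity) (by linarith)
    (Finset.sum_nonneg fun i _ => ENNReal.toReal_nonneg) ?_ ?_
  · rw [Finset.mul_sum]
    refine Finset.sum_le_sum fun i _ => (hD i).2.trans_eq (by ring)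
  · have h1 : (∑ i ∈ Sᶜ, (N i / totalWeight N : ℝ)) / α ≤ ∑ i ∈ Sᶜ, (D i).toReal := by
      rw [Finset.sum_div]
      refine Finset.sum_le_sum fun i _ => le_trans (le_of_eq ?_) (hD i).1
      rw [div_div, mul_comm]
    have h2 : 1 - ∑ i ∈ S, (N i / totalWeight N : ℝ) = ∑ i ∈ Sᶜ, (N i / totalWeight N : ℝ) := by
      linarith
    rw [h2]
    linarith

/-- The drift inequality. With `a = ε / 32` the second-order terms of size `a ^ 2` use up only half
of the negative drift. -/
theorem sum_sum_mul_nextBound_le {ε : ℝ} (hε : 0 < ε) (hε1 : ε < 1) (hN : ∀ i, 0 < N i)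
    (hW : 0 < totalWeight N) {d : Fin n → ℝ} (hd1 : ∑ i, d i = 1)
    (hmass : ∀ S : Finset (Fin n), (∑ i ∈ S, d i) ^ 2 ≤
      (1 - ε) * ∑ i ∈ S, (N i / totalWeight N : ℝ) +
        ε * (∑ i ∈ S, (N i / totalWeight N : ℝ)) ^ 2) (w : Fin n → ℕ) :
    ∑ x, ∑ y, d x * d y * nextBound N (ε / 32) w x y ≤
      (1 - ε ^ 2 / (512 * totalWeight N)) * potential N (ε / 32) w + ε ^ 2 / 256 := by
  have hW' : (0 : ℝ) < totalWeight N := by exact_mod_cast hW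
  set a := ε / 32 with ha
  set W : ℝ := (totalWeight N : ℝ) with hWdef
  set V := potential N a w with hV
  set G := increment N a w with hG
  set h := deviation N a w with hh
  set s := ∑ j, (N j : ℝ) * Real.sinh (h j) with hs
  have hν1 : ∑ i, (N i / W : ℝ) = 1 := by
    rw [← Finset.sum_div, hWdef, ← cast_totalWeight, div_self hW'.ne']
  have e1 : ∑ x, ∑ y, d x * d y * nextBound N a w x y =
      (V + a ^ 2 * V / W - a / W * s) + ∑ x, ∑ y, d x * d y * min (G x) (G y) := by
    have : ∑ x, ∑ y, d x * d y * (V + a ^ 2 * V / W - a / W * s) =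
        V + a ^ 2 * V / W - a / W * s := by
      simp_rw [← Finset.sum_mul, ← Finset.mul_sum]
      simp only [hd1, mul_one, one_mul]
    rw [← this]
    simp_rw [← Finset.sum_add_distrib]
    exact Finset.sum_congr rfl fun x _ => Finset.sum_congr rfl fun y _ => by
      rw [nextBound]; ring
  have h1 := sum_sum_mul_min_le hd1 hν1 hmass G
  have e2 : ∑ x, (N x / W : ℝ) * G x = a / W * s + a ^ 2 * V / W := by
    rw [hs, hV, potential, Finset.mul_sum, Finset.mul_sum, Finset.sum_div,
      ← Finset.sum_add_distrib]
    exact Finset.sum_congr rfl fun x _ => by rw [hG, increment]; ring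
  have h2 : a / 2 * ∑ x, ∑ y, (N x / W : ℝ) * (N y / W : ℝ) *
      |Real.sinh (h x) - Real.sinh (h y)| ≤
      ∑ x, ∑ y, (N x / W : ℝ) * (N y / W : ℝ) * |G x - G y| := by
    simp_rw [Finset.mul_sum]
    refine Finset.sum_le_sum fun x _ => Finset.sum_le_sum fun y _ => ?_
    have := mul_le_mul_of_nonneg_left
      (mul_abs_sinh_sub_le_abs_increment_sub N (a := a) (by positivity) (by linarith) w x y)
      (show 0 ≤ (N x / W : ℝ) * (N y / W : ℝ) by positivity)
    linarith
  have h3 := potential_le_sum_abs_sinh_sub hN hW a w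
  rw [← hWdef, ← hV, ← hh] at h3
  set g := ∑ x, ∑ y, (N x / W : ℝ) * (N y / W : ℝ) * |Real.sinh (h x) - Real.sinh (h y)|
  have h4 : ε / 2 * (a / 2 * ((V / W - 1) / 2)) ≤ ε / 2 * (a / 2 * g) := by
    have : (V / W - 1) / 2 ≤ g := by linarith
    gcongr
  have h5 := mul_le_mul_of_nonneg_left h2 (show 0 ≤ ε / 2 by positivity)
  rw [e2] at h1
  rw [e1]
  have e3 : ε ^ 2 / (512 * W) * V = ε ^ 2 / 512 * (V / W) := by field_simp
  have e4 : a ^ 2 * V / W = ε ^ 2 / 1024 * (V / W) := by rw [ha]; field_simp; ring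
  have e5 : ε / 2 * (a / 2 * ((V / W - 1) / 2)) = ε ^ 2 / 256 * (V / W) - ε ^ 2 / 256 := by
    rw [ha]; ring
  rw [sub_mul, one_mul, e3]
  linarith

/-! ### Expectations of the potential -/

/-- The expectation of an extended nonnegative function under a discrete law. -/
noncomputable def mean {Ω : Type*} (p : PMF Ω) (f : Ω → ENNReal) : ENNReal := ∑' ω, p ω * f ω

theorem mean_pure {Ω : Type*} (x : Ω) (f : Ω → ENNReal) : mean (PMF.pure x) f = f x := by
  rw [mean, tsum_eq_single x]
  · simp
  · intro y hy
    simp [PMF.pure_apply, hy]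

theorem mean_bind {Ω Ω' : Type*} (p : PMF Ω) (q : Ω → PMF Ω') (f : Ω' → ENNReal) :
    mean (p.bind q) f = mean p fun x => mean (q x) f := by
  simp only [mean, PMF.bind_apply, ← ENNReal.tsum_mul_right, ← ENNReal.tsum_mul_left]
  rw [ENNReal.tsum_comm]
  simp only [mul_assoc]

theorem mean_mono {Ω : Type*} (p : PMF Ω) {f g : Ω → ENNReal} (h : ∀ ω, f ω ≤ g ω) :
    mean p f ≤ mean p g :=
  ENNReal.tsum_le_tsum fun ω => mul_le_mul_right (h ω) _

theorem mean_const {Ω : Type*} (p : PMF Ω) (c : ENNReal) : mean p (fun _ => c) = c := by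
  rw [mean, ENNReal.tsum_mul_right, p.tsum_coe, one_mul]

theorem mean_mul_add {Ω : Type*} (p : PMF Ω) (f : Ω → ENNReal) (b c : ENNReal) :
    mean p (fun ω => b * f ω + c) = b * mean p f + c := by
  simp only [mean, mul_add, ENNReal.tsum_add, ENNReal.tsum_mul_right, p.tsum_coe, one_mul]
  rw [← ENNReal.tsum_mul_left]
  congr 2
  ext ω
  ring

theorem mean_ofReal_fintype {Ω : Type*} [Fintype Ω] (p : PMF Ω) {f : Ω → ℝ}
    (hf : ∀ ω, 0 ≤ f ω) :
    mean p (fun ω => ENNReal.ofReal (f ω)) = ENNReal.ofReal (∑ ω, (p ω).toReal * f ω) := by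
  rw [mean, tsum_fintype, ENNReal.ofReal_sum_of_nonneg fun ω _ =>
    mul_nonneg ENNReal.toReal_nonneg (hf ω)]
  refine Finset.sum_congr rfl fun ω _ => ?_
  rw [ENNReal.ofReal_mul ENNReal.toReal_nonneg, ENNReal.ofReal_toReal (p.apply_ne_top ω)]

theorem sum_toReal {Ω : Type*} [Fintype Ω] (p : PMF Ω) : ∑ ω, (p ω).toReal = 1 := by
  rw [← ENNReal.toReal_sum fun ω _ => p.apply_ne_top ω, ← tsum_fintype (L := .unconditional _),
    p.tsum_coe, ENNReal.toReal_one]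

/-- Markov's inequality. -/
theorem toMeasure_real_le_div {Ω : Type*} [MeasurableSpace Ω] [DiscreteMeasurableSpace Ω]
    (p : PMF Ω) {f : Ω → ℝ} {S : Set Ω} {c M : ℝ} (hc : 0 < c) (hM : 0 ≤ M)
    (hS : ∀ ω ∈ S, c ≤ f ω) (hf : mean p (fun ω => ENNReal.ofReal (f ω)) ≤ ENNReal.ofReal M) :
    p.toMeasure.real S ≤ M / c := by
  have h1 : ENNReal.ofReal c * p.toMeasure S ≤ ENNReal.ofReal M := by
    refine le_trans ?_ hf
    rw [PMF.toMeasure_apply _ (MeasurableSet.of_discrete), ← ENNReal.tsum_mul_left]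
    refine ENNReal.tsum_le_tsum fun ω => ?_
    by_cases hω : ω ∈ S
    · rw [Set.indicator_of_mem hω, mul_comm]
      exact mul_le_mul_right (ENNReal.ofReal_le_ofReal (hS ω hω)) _
    · simp [Set.indicator_of_notMem hω]
  have h2 := ENNReal.toReal_mono ENNReal.ofReal_ne_top h1
  rw [ENNReal.toReal_mul, ENNReal.toReal_ofReal hc.le, ENNReal.toReal_ofReal hM] at h2
  rw [le_div_iff₀ hc, mul_comm]
  exact h2

theorem mean_step_le (hN : ∀ i, 0 < N i) {a : ℝ} (ha : 0 ≤ a) (ha1 : a ≤ 1)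
    (D : PMF (Fin n)) (τ : Fin n → Fin n → PMF Bool) (w : Fin n → ℕ) :
    mean (D.bind fun x => D.bind fun y => (τ x y).bind fun b =>
        PMF.pure (w + Pi.single (chosenBin N w x y b) 1))
      (fun w' => ENNReal.ofReal (potential N a w')) ≤
    ENNReal.ofReal (∑ x, ∑ y, (D x).toReal * (D y).toReal * nextBound N a w x y) := by
  have hnn : ∀ x y, 0 ≤ nextBound N a w x y := fun x y =>
    (potential_nonneg N a _).trans (potential_add_chosenBin_le hN ha ha1 w x y true)
  simp only [mean_bind, mean_pure]
  calc _ ≤ mean D fun x => mean D fun y => ENNReal.ofReal (nextBound N a w x y) := by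
        refine mean_mono _ fun x => mean_mono _ fun y => ?_
        refine (mean_mono _ fun b => ENNReal.ofReal_le_ofReal
          (potential_add_chosenBin_le hN ha ha1 w x y b)).trans_eq (mean_const _ _)
    _ = ENNReal.ofReal (∑ x, (D x).toReal * ∑ y, (D y).toReal * nextBound N a w x y) := by
        simp_rw [mean_ofReal_fintype D (hnn _)]
        exact mean_ofReal_fintype D fun x =>
          Finset.sum_nonneg fun y _ => mul_nonneg ENNReal.toReal_nonneg (hnn x y)
    _ = _ := by simp_rw [Finset.mul_sum, mul_assoc]

theorem potential_zero (N : Fin n → ℕ) (a : ℝ) : potential N a 0 = totalWeight N := by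
  simp [potential, deviation, value, cast_totalWeight]

/-- At all times the potential has expectation at most `2 * totalWeight N`, the fixed point of the
drift inequality. -/
theorem mean_potential_le {ε : ℝ} (hε : 0 < ε) (hε1 : ε < 1) (hN : ∀ i, 0 < N i)
    (hW : 0 < totalWeight N) (D : PMF (Fin n))
    (hmass : ∀ S : Finset (Fin n), (∑ i ∈ S, (D i).toReal) ^ 2 ≤
      (1 - ε) * ∑ i ∈ S, (N i / totalWeight N : ℝ) +
        ε * (∑ i ∈ S, (N i / totalWeight N : ℝ)) ^ 2) (τ : TieRule n) (t : ℕ) :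
    mean (loadLaw N D τ t) (fun w => ENNReal.ofReal (potential N (ε / 32) w)) ≤
      ENNReal.ofReal (2 * totalWeight N) := by
  have hW1 : (1 : ℝ) ≤ totalWeight N := by exact_mod_cast hW
  have hW0 : (0 : ℝ) < totalWeight N := by linarith
  induction t with
  | zero =>
    rw [loadLaw, mean_pure, potential_zero]
    exact ENNReal.ofReal_le_ofReal (by linarith)
  | succ t ih =>
    set r : ℝ := 1 - ε ^ 2 / (512 * totalWeight N) with hr
    have hr0 : 0 ≤ r := sub_nonneg.2 ((div_le_one (by positivity)).2 (by nlinarith))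
    rw [loadLaw, mean_bind]
    calc _ ≤ mean (loadLaw N D τ t) fun w => ENNReal.ofReal r *
          ENNReal.ofReal (potential N (ε / 32) w) + ENNReal.ofReal (ε ^ 2 / 256) := by
          refine mean_mono _ fun w => (mean_step_le hN (by linarith) (by linarith) D _ w).trans ?_
          rw [← ENNReal.ofReal_mul hr0, ← ENNReal.ofReal_add
            (mul_nonneg hr0 (potential_nonneg _ _ _)) (by positivity)]
          exact ENNReal.ofReal_le_ofReal
            (sum_sum_mul_nextBound_le hε hε1 hN hW (sum_toReal D) hmass w)
      _ ≤ ENNReal.ofReal r * ENNReal.ofReal (2 * totalWeight N) + ENNReal.ofReal (ε ^ 2 / 256) := by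
          rw [mean_mul_add]
          gcongr
      _ = ENNReal.ofReal (2 * totalWeight N) := by
          rw [← ENNReal.ofReal_mul hr0, ← ENNReal.ofReal_add (by positivity) (by positivity), hr]
          congr 1
          field_simp
          ring

/-! ### From the potential to the gap -/

theorem exp_gap_le_potential (hn : Nonempty (Fin n)) (hN : ∀ i, 0 < N i) {a : ℝ} (w : Fin n → ℕ) :
    Real.exp (a / 2 * gap N w) ≤ 2 * potential N a w := by
  obtain ⟨i, hi⟩ := exists_eq_ciSup_of_finite (f := value N w)
  obtain ⟨j, hj⟩ := exists_eq_ciInf_of_finite (f := value N w)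
  have hgap : a * gap N w = deviation N a w i - deviation N a w j := by
    rw [gap, ← hi, ← hj, deviation, deviation]
    ring
  have hcosh : ∀ k, Real.cosh (deviation N a w k) ≤ potential N a w := fun k => by
    have h1 : (1 : ℝ) ≤ N k := by exact_mod_cast hN k
    have h2 := Finset.single_le_sum
      (f := fun k => (N k : ℝ) * Real.cosh (deviation N a w k))
      (fun k _ => mul_nonneg (Nat.cast_nonneg _) (Real.cosh_pos _).le) (Finset.mem_univ k)
    exact (le_mul_of_one_le_left (Real.cosh_pos _).le h1).trans h2
  -- One of the two extreme deviations is at least half the gap in absolute value.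
  rcases le_total (deviation N a w i + deviation N a w j) 0 with h | h
  · have h1 : Real.exp (a / 2 * gap N w) ≤ Real.exp (-deviation N a w j) :=
      Real.exp_le_exp.2 (by linarith)
    have h2 := hcosh j
    rw [Real.cosh_eq] at h2
    have := Real.exp_pos (deviation N a w j)
    linarith
  · have h1 : Real.exp (a / 2 * gap N w) ≤ Real.exp (deviation N a w i) :=
      Real.exp_le_exp.2 (by linarith)
    have h2 := hcosh i
    rw [Real.cosh_eq] at h2
    have := Real.exp_pos (-deviation N a w i)
    linarith

end BallsBins

theorem mainTheorem3 (ε : ℝ) (hε : 0 < ε) :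
    ∃ a c : ℝ, 0 < a ∧ 0 < c ∧
      ∀ (n : ℕ) (N : Fin n → ℕ) (_hN : ∀ i, 0 < N i)
        (α β : ℝ) (_hα : 1 < α) (_hβ : 1 < β)
        (_hεαβ : ε ≤ 2 * Real.log ((α * β - 1) / (α * β - β)) /
          Real.log ((α * β - 1) / (α - 1)) - 1)
        (D : PMF (Fin n)) (_hD : BallsBins.IsBiased N α β D)
        (τ : BallsBins.TieRule n)
        (k : ℝ) (_hk : 0 < k) (t : ℕ),
        (BallsBins.loadLaw N D τ t).toMeasure.real
            {w | k / a * Real.log (c / (2 * a) * BallsBins.totalWeight N) ≤ BallsBins.gap N w}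
          ≤ (BallsBins.totalWeight N : ℝ) ^ (-(k - 1)) := by
  -- `a` is half the parameter of the potential, which bounds `exp (a * gap)`; `c / (2 * a) = 4`
  -- absorbs the constant in Markov's inequality.
  refine ⟨ε / 64, ε / 8, by positivity, by positivity, ?_⟩
  intro n N hN α β hα hβ h D hD τ k hk t
  obtain ⟨i₀, -⟩ := D.support_nonempty
  have hW : 0 < BallsBins.totalWeight N := (hN i₀).trans_le (BallsBins.le_totalWeight N i₀)
  have hε1 := BallsBins.epsilon_lt_one hα hβ h
  set W : ℝ := (BallsBins.totalWeight N : ℝ) with hWdef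
  have hW1 : 1 ≤ W := by rw [hWdef]; exact_mod_cast hW
  have hW0 : 0 < W := by linarith
  rcases le_total k 1 with hk1 | hk1
  · exact MeasureTheory.measureReal_le_one.trans (Real.one_le_rpow hW1 (by linarith))
  have hmean := BallsBins.mean_potential_le hε hε1 hN hW D
    (hD.sum_sq_le hε hα hβ h hW (BallsBins.sum_toReal D)) τ t
  have hc : ε / 8 / (2 * (ε / 64)) = 4 := by field_simp; norm_num
  have hmarkov := BallsBins.toMeasure_real_le_div (c := (4 * W) ^ k / 2) (M := 2 * W)
    (S := {w | k / (ε / 64) * Real.log (ε / 8 / (2 * (ε / 64)) * W) ≤ BallsBins.gap N w})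
    (BallsBins.loadLaw N D τ t) (by positivity) (by positivity) ?_ hmean
  · refine hmarkov.trans ?_
    have h4 : (4 : ℝ) ≤ 4 ^ k := by simpa using Real.rpow_le_rpow_of_exponent_le (by norm_num) hk1
    have hWk : 0 < W ^ k := by positivity
    rw [Real.mul_rpow (by norm_num) hW0.le, neg_sub, Real.rpow_sub hW0, Real.rpow_one,
      div_le_div_iff₀ (by positivity) hWk]
    nlinarith [mul_le_mul_of_nonneg_right h4 (mul_nonneg hW0.le hWk.le)]
  · intro w hw
    rw [Set.mem_ofPred_eq, hc] at hw
    have h1 := BallsBins.exp_gap_le_potential ⟨i₀⟩ hN (a := ε / 32) w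
    have h2 : (4 * W) ^ k ≤ Real.exp (ε / 32 / 2 * BallsBins.gap N w) := by
      rw [Real.rpow_def_of_pos (by positivity), Real.exp_le_exp]
      calc Real.log (4 * W) * k = ε / 64 * (k / (ε / 64) * Real.log (4 * W)) := by
            field_simp
        _ ≤ ε / 64 * BallsBins.gap N w := by gcongr
        _ = _ := by ring
    linarith
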